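/- Let $0<\alpha<r$ and $d\in\mathbb{R}$. There is a constant $A>0$, depending only on $(\alpha,r,d)$, such that the following holds. Let $S\subset\mathbb{R}^2$ be a compact set of diameter $d$ such that both $S$ and $S^{\mathsf c}=\mathbb{R}^2\setminus S$ satisfy the $r$-rolling condition, where a set $T\subset\mathbb{R}^2$ satisfies the $r$-rolling condition if for every $x\in\partial T$ there is an open ball $B$ of radius $r$ with $x\in\partial B$ and $B\cap T=\emptyset$. Let $X_1,\dots,X_n$ be independent and uniformly distributed on $S$, and let $\mathcal X_n=\{X_1,\dots,X_n\}$. A segment $[xy]$ with distinct endpoints $x,y\in\mathcal X_n$ is an $\alpha$-edge if there is an open ball $B$ of radius $\alpha$ with $x,y\in\partial B$ and $B\cap\mathcal X_n=\emptyset$. Then, for every $n$, with probability at least $1-Ae^{-n/A}$, both of the following hold: (i) every $\alpha$-edge $[xy]$ is one-sided, that is, at least one open ball of radius $\alpha$ whose boundary contains $x$ and $y$ contains a point of $\mathcal X_n$; (ii) every point of the union $C_\alpha$ of all $\alpha$-edges has a unique nearest point in $\partial S$, and the metric projection onto $\partial S$, which maps a point to its nearest point in $\partial S$, is injective on $C_\alpha$.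 -/

import Mathlib

/-- The Euclidean plane. -/
abbrev Plane : Type := EuclideanSpace ℝ (Fin 2)

/-- The `r`-rolling condition: every boundary point `x` of `S` lies on the boundary of an open ball
of radius `r` that is disjoint from `S`. -/
def RollingCondition (r : ℝ) (S : Set Plane) : Prop :=
  ∀ x ∈ frontier S, ∃ c : Plane, x ∈ Metric.sphere c r ∧ Disjoint (Metric.ball c r) S

/-- The (set-valued) metric projection onto `Γ`: the set of points of `Γ` nearest to `x`. -/
def metricProjection (Γ : Set Plane) (x : Plane) : Set Plane :=
  {y | y ∈ Γ ∧ ∀ z ∈ Γ, dist x y ≤ dist x z}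

/-- The metric projection onto `Γ` is single-valued and injective on `C`. -/
def MetricProjectionInjectiveOn (Γ C : Set Plane) : Prop :=
  (∀ x ∈ C, ∃ y, metricProjection Γ x = {y}) ∧ Set.InjOn (metricProjection Γ) C

/-- The open ball of radius `α` about `c` circumscribes the pair `x`, `y`. -/
def Circumscribes (α : ℝ) (c x y : Plane) : Prop :=
  x ∈ Metric.sphere c α ∧ y ∈ Metric.sphere c α

/-- The distinct points `x`, `y` of `D` form an `α`-edge of `D`: some open ball of radius `α` that
circumscribes them contains no point of `D`. -/
def IsAlphaEdge (α : ℝ) (D : Set Plane) (x y : Plane) : Prop :=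
  x ∈ D ∧ y ∈ D ∧ x ≠ y ∧ ∃ c : Plane, Circumscribes α c x y ∧ Disjoint (Metric.ball c α) D

/-- Some open ball of radius `α` that circumscribes `x`, `y` contains a point of `D`. -/
def IsOneSided (α : ℝ) (D : Set Plane) (x y : Plane) : Prop :=
  ∃ c : Plane, Circumscribes α c x y ∧ (Metric.ball c α ∩ D).Nonempty

/-- The union of all `α`-edges of `D`, as line segments. -/
def alphaEdgeUnion (α : ℝ) (D : Set Plane) : Set Plane :=
  {p | ∃ x y : Plane, IsAlphaEdge α D x y ∧ p ∈ segment ℝ x y}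

/-! The two rolling conditions give every boundary point a normal with an `r`-ball outside `S` on
one side and an `r`-ball inside `S` on the other. Outer and inner balls at different points are
disjoint, so normals are `1/r`-Lipschitz (`IsRollingNormal.norm_sub_le`), and a point lies on the
normal line of any of its nearest boundary points.

Let the sample be ε-dense in `S`. Shrinking the empty ball of an α-edge by ε gives a ball that
misses `S`. As α < r, both endpoints are then close to the foot of the centre, and the centre lies
almost straight above them along the normal (`foot_estimates`, `isFlatEdge_of_disjoint`). The other
ball through the endpoints has its centre below them, so it cannot be empty too; this is
one-sidedness.

Two edge points with the same projection `q` lie on the normal line at `q`. With this normal drawn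
vertically, the endpoints of each edge lie on the lower arc of its empty circle and not above the
arc of the other edge. Lower arcs of equal radius with distinct centres cross at most once, so the
edges share at most one abscissa, where their heights agree (`chord_height_eq`). If the centres
coincide, so do the edges, because almost surely no circle of radius α carries three sample points.

Density fails with exponentially small probability: finitely many small balls have to be hit, and
each contains a smaller ball inside `S`, so its mass is bounded below in terms of α, r and d alone.
-/

/-! ### Rolling normals and the metric projection. -/

section Geometry

open Metric

/-- `n` is a unit normal of `S` at `q` whose open ball of radius `r` on the side of `n` avoids `S`
and whose opposite open ball of radius `r` is contained in `S`. -/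
structure IsRollingNormal (r : ℝ) (S : Set Plane) (q n : Plane) : Prop where
  norm_eq : ‖n‖ = 1
  outside : Disjoint (ball (q + r • n) r) S
  inside : Disjoint (ball (q - r • n) r) Sᶜ

theorem IsRollingNormal.compl {r : ℝ} {S : Set Plane} {q n : Plane}
    (h : IsRollingNormal r S q n) : IsRollingNormal r Sᶜ q (-n) where
  norm_eq := by rw [norm_neg, h.norm_eq]
  outside := by simpa [sub_eq_add_neg] using h.inside
  inside := by simpa using h.outside

/-- The equality case of the triangle inequality for vectors pointing in opposite directions. -/
theorem smul_add_smul_eq_zero_of_add_le_norm_sub {E : Type*} [NormedAddCommGroup E]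
    [InnerProductSpace ℝ E] {a b : E} (h : ‖a‖ + ‖b‖ ≤ ‖a - b‖) : ‖b‖ • a + ‖a‖ • b = 0 := by
  have h1 : (‖a‖ + ‖b‖) ^ 2 ≤ ‖a - b‖ ^ 2 := by gcongr
  rw [norm_sub_sq_real] at h1
  have h2 : ‖‖b‖ • a + ‖a‖ • b‖ ^ 2 ≤ 0 := by
    rw [norm_add_sq_real, norm_smul, norm_smul, inner_smul_left, inner_smul_right]
    simp only [norm_norm, conj_trivial]
    have h3 : inner ℝ a b ≤ -(‖a‖ * ‖b‖) := by nlinarith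
    have h4 : 0 ≤ ‖a‖ * ‖b‖ := by positivity
    nlinarith [mul_le_mul_of_nonneg_left h3 h4]
  exact norm_eq_zero.1 (pow_eq_zero_iff two_ne_zero |>.1 (le_antisymm h2 (sq_nonneg _)))

/-- The outer and inner balls at `q` are disjoint, so their centres are at least `2r` apart while
both are at distance `r` from `q`; hence they are antipodal about `q`. -/
theorem exists_isRollingNormal {r : ℝ} (hr : 0 < r) {S : Set Plane} (hS : RollingCondition r S)
    (hSc : RollingCondition r Sᶜ) {q : Plane} (hq : q ∈ frontier S) :
    ∃ n, IsRollingNormal r S q n := by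
  obtain ⟨o, ho, hoS⟩ := hS q hq
  obtain ⟨i, hi, hiS⟩ := hSc q (by rwa [frontier_compl])
  have hdis : Disjoint (ball o r) (ball i r) :=
    hoS.mono_right (Set.disjoint_compl_right_iff_subset.1 hiS)
  rw [disjoint_ball_ball_iff hr hr] at hdis
  have ho' : ‖o - q‖ = r := by rw [← dist_eq_norm, dist_comm]; exact ho
  have hi' : ‖i - q‖ = r := by rw [← dist_eq_norm, dist_comm]; exact hi
  have h0 := smul_add_smul_eq_zero_of_add_le_norm_sub (a := o - q) (b := i - q) (by
    rw [ho', hi', sub_sub_sub_cancel_right, ← dist_eq_norm]; exact hdis)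
  rw [ho', hi', ← smul_add, smul_eq_zero, or_iff_right hr.ne'] at h0
  have h1 : r • r⁻¹ • (o - q) = o - q := smul_inv_smul₀ hr.ne' _
  refine ⟨r⁻¹ • (o - q), ?_, ?_, ?_⟩
  · rw [norm_smul, ho', norm_inv, Real.norm_of_nonneg hr.le, inv_mul_cancel₀ hr.ne']
  · rw [h1]; simpa using hoS
  · have : q - (o - q) = i := by
      rw [← sub_eq_zero, ← neg_eq_zero, ← h0]; abel
    rw [h1, this]; exact hiS

/-- Rolling normals are Lipschitz. -/
theorem IsRollingNormal.norm_sub_le {r : ℝ} (hr : 0 < r) {S : Set Plane} {p q m n : Plane}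
    (hm : IsRollingNormal r S p m) (hn : IsRollingNormal r S q n) :
    r * ‖m - n‖ ≤ ‖p - q‖ := by
  have h1 : Disjoint (ball (p + r • m) r) (ball (q - r • n) r) :=
    hm.outside.mono_right (Set.disjoint_compl_right_iff_subset.1 hn.inside)
  have h2 : Disjoint (ball (q + r • n) r) (ball (p - r • m) r) :=
    hn.outside.mono_right (Set.disjoint_compl_right_iff_subset.1 hm.inside)
  rw [disjoint_ball_ball_iff hr hr, dist_eq_norm] at h1 h2
  have e1 : p + r • m - (q - r • n) = (p - q) + r • (m + n) := by module
  have e2 : q + r • n - (p - r • m) = -((p - q) - r • (m + n)) := by module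
  rw [e1] at h1
  rw [e2, norm_neg] at h2
  have h1' : (r + r) ^ 2 ≤ ‖(p - q) + r • (m + n)‖ ^ 2 := by gcongr
  have h2' : (r + r) ^ 2 ≤ ‖(p - q) - r • (m + n)‖ ^ 2 := by gcongr
  rw [norm_add_sq_real, norm_smul, mul_pow, Real.norm_of_nonneg hr.le, norm_add_sq_real m n,
    hm.norm_eq, hn.norm_eq] at h1'
  rw [norm_sub_sq_real, norm_smul, mul_pow, Real.norm_of_nonneg hr.le, norm_add_sq_real m n,
    hm.norm_eq, hn.norm_eq] at h2'
  -- Adding `h1'` and `h2'` cancels the cross terms; the inner product of `m` and `n` then turns `‖m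
  -- + n‖²` into `4 - ‖m - n‖²`.
  refine le_of_sq_le_sq ?_ (norm_nonneg _)
  rw [mul_pow, norm_sub_sq_real m n, hm.norm_eq, hn.norm_eq]
  nlinarith

theorem disjoint_or_disjoint_compl_of_disjoint_frontier {S B : Set Plane} (hB : IsPreconnected B)
    (h : Disjoint B (frontier S)) : Disjoint B S ∨ Disjoint B Sᶜ := by
  have hcov : B ⊆ interior S ∪ interior Sᶜ := by
    intro x hx
    have hx' := Set.disjoint_left.1 h hx
    rw [interior_compl]
    by_contra hcon
    simp only [Set.mem_union, Set.mem_compl_iff, not_or, not_not] at hcon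
    exact hx' ⟨hcon.2, hcon.1⟩
  have hdis : Disjoint (interior S) (interior Sᶜ) :=
    disjoint_compl_right.mono interior_subset interior_subset
  rcases hB.subset_or_subset isOpen_interior isOpen_interior hdis hcov with h' | h'
  · exact Or.inr (Set.disjoint_compl_right_iff_subset.2 (h'.trans interior_subset))
  · exact Or.inl (Set.subset_compl_iff_disjoint_right.1 (h'.trans interior_subset))

/-- A point whose distance ball misses `S` lies on the outer normal at its foot. -/
theorem IsRollingNormal.eq_add_of_disjoint {r : ℝ} (hr : 0 < r) {S : Set Plane} {q n z : Plane}
    (hn : IsRollingNormal r S q n) (h : Disjoint (ball z (dist z q)) S) :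
    z = q + dist z q • n := by
  rcases eq_or_ne z q with rfl | hne
  · simp
  have hd : Disjoint (ball z (dist z q)) (ball (q - r • n) r) :=
    h.mono_right (Set.disjoint_compl_right_iff_subset.1 hn.inside)
  rw [disjoint_ball_ball_iff (dist_pos.2 hne) hr, dist_eq_norm, dist_eq_norm] at hd
  have hb : ‖-(r • n)‖ = r := by
    rw [norm_neg, norm_smul, hn.norm_eq, mul_one, Real.norm_of_nonneg hr.le]
  have h0 := smul_add_smul_eq_zero_of_add_le_norm_sub (a := z - q) (b := -(r • n)) (by
    rw [hb, show z - q - -(r • n) = z - (q - r • n) by abel]; exact hd)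
  rw [hb, smul_neg, smul_comm, ← smul_neg, ← smul_add, smul_eq_zero, or_iff_right hr.ne',
    ← sub_eq_add_neg, sub_eq_zero, ← dist_eq_norm] at h0
  rw [← h0]; abel

/-- A point at offset less than `r` on the outer normal at `q` projects onto `q` only. -/
theorem IsRollingNormal.metricProjection_add {r : ℝ} {S : Set Plane} {q n : Plane}
    (hn : IsRollingNormal r S q n) (hq : q ∈ frontier S) {s : ℝ} (hs : 0 ≤ s) (hsr : s < r) :
    metricProjection (frontier S) (q + s • n) = {q} := by
  have hr : 0 < r := hs.trans_lt hsr
  have hdq : dist (q + s • n) q = s := by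
    rw [dist_eq_norm, add_sub_cancel_left, norm_smul, hn.norm_eq, mul_one, Real.norm_of_nonneg hs]
  -- The outer `r`-ball at `q` excludes `y`, which bounds the normal component of `y - q` by `‖y -
  -- q‖² / (2r)`.
  have key : ∀ y ∈ frontier S, s ^ 2 + dist y q ^ 2 * (1 - s / r) ≤ dist (q + s • n) y ^ 2 := by
    intro y hy
    have h1 : y ∉ ball (q + r • n) r := fun hy' =>
      Set.disjoint_left.1 (hn.outside.closure_right isOpen_ball) hy' hy.1
    rw [mem_ball, not_lt, dist_eq_norm] at h1
    have h2 : r ^ 2 ≤ ‖y - (q + r • n)‖ ^ 2 := by gcongr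
    have e1 : y - (q + r • n) = (y - q) - r • n := by abel
    have e2 : y - (q + s • n) = (y - q) - s • n := by abel
    rw [e1, norm_sub_sq_real, norm_smul, hn.norm_eq, inner_smul_right, mul_one,
      Real.norm_of_nonneg hr.le] at h2
    rw [dist_comm _ y, dist_eq_norm, dist_eq_norm, e2, norm_sub_sq_real (y - q), norm_smul, hn.norm_eq,
      inner_smul_right, mul_one, Real.norm_of_nonneg hs]
    have h3 : 2 * inner ℝ (y - q) n ≤ ‖y - q‖ ^ 2 / r := by
      rw [le_div_iff₀ hr]; linarith
    have h4 := mul_le_mul_of_nonneg_left h3 hs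
    have h5 : ‖y - q‖ ^ 2 * (1 - s / r) = ‖y - q‖ ^ 2 - s * (‖y - q‖ ^ 2 / r) := by ring
    rw [h5]; linarith
  have hpos : 0 < 1 - s / r := by rw [sub_pos, div_lt_one hr]; exact hsr
  ext y
  simp only [metricProjection, Set.mem_ofPred_eq, Set.mem_singleton_iff]
  constructor
  · rintro ⟨hy, hmin⟩
    have h1 := hmin q hq
    rw [hdq] at h1
    have h2 : dist (q + s • n) y ^ 2 ≤ s ^ 2 := by gcongr
    have h3 := key y hy
    have h4 : dist y q ^ 2 * (1 - s / r) ≤ 0 := by linarith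
    have h5 : dist y q ^ 2 ≤ 0 := nonpos_of_mul_nonpos_left h4 hpos
    exact dist_eq_zero.1 (pow_eq_zero_iff two_ne_zero |>.1 (le_antisymm h5 (sq_nonneg _)))
  · intro hyq
    rw [hyq]
    refine ⟨hq, fun y hy => ?_⟩
    rw [hdq]
    refine le_of_sq_le_sq ?_ dist_nonneg
    have := key y hy
    nlinarith [mul_nonneg (sq_nonneg (dist y q)) hpos.le, this]

/-- A point `z` with nearest frontier point `q` lies on the normal line at `q`. -/
theorem IsRollingNormal.exists_eq_add {r : ℝ} (hr : 0 < r) {S : Set Plane} {q n z : Plane}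
    (hn : IsRollingNormal r S q n) (hq : q ∈ metricProjection (frontier S) z) :
    (Disjoint (ball z (dist z q)) S ∧ z = q + dist z q • n) ∨
      (Disjoint (ball z (dist z q)) Sᶜ ∧ z = q - dist z q • n) := by
  have hdis : Disjoint (ball z (dist z q)) (frontier S) := by
    refine Set.disjoint_left.2 fun y hy hyS => ?_
    rw [mem_ball, dist_comm] at hy
    exact hy.not_ge (hq.2 y hyS)
  rcases disjoint_or_disjoint_compl_of_disjoint_frontier
    (convex_ball z (dist z q)).isPreconnected hdis with h | h
  · exact Or.inl ⟨h, hn.eq_add_of_disjoint hr h⟩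
  · refine Or.inr ⟨h, ?_⟩
    have := hn.compl.eq_add_of_disjoint hr h
    rwa [smul_neg, ← sub_eq_add_neg] at this

theorem IsRollingNormal.metricProjection_eq {r : ℝ} (hr : 0 < r) {S : Set Plane} {q n z : Plane}
    (hn : IsRollingNormal r S q n) (hq : q ∈ metricProjection (frontier S) z)
    (hz : dist z q < r) : metricProjection (frontier S) z = {q} := by
  rcases hn.exists_eq_add hr hq with ⟨-, h⟩ | ⟨-, h⟩
  · rw [h]; exact hn.metricProjection_add hq.1 dist_nonneg hz
  · have := hn.compl.metricProjection_add (by rw [frontier_compl]; exact hq.1) dist_nonneg hz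
    rw [frontier_compl, smul_neg, ← sub_eq_add_neg, ← h] at this
    exact this

theorem exists_mem_metricProjection {Γ : Set Plane} (hΓ : IsCompact Γ) (hne : Γ.Nonempty)
    (z : Plane) : ∃ q, q ∈ metricProjection Γ z := by
  obtain ⟨q, hq, h⟩ := hΓ.exists_infDist_eq_dist hne z
  exact ⟨q, hq, fun y hy => h ▸ infDist_le_dist_of_mem hy⟩

end Geometry

/-! ### Lower arcs of circles of equal radius. -/

section LowerArcs

theorem strictConcaveOn_sqrt_sq_sub_sq (α : ℝ) :
    StrictConcaveOn ℝ (Set.Icc (-α) α) fun s => √(α ^ 2 - s ^ 2) := by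
  refine ⟨convex_Icc _ _, fun x hx y hy hxy a b ha hb hab => ?_⟩
  have hx' : 0 ≤ α ^ 2 - x ^ 2 := sub_nonneg.2 (sq_le_sq' hx.1 hx.2)
  have hy' : 0 ≤ α ^ 2 - y ^ 2 := sub_nonneg.2 (sq_le_sq' hy.1 hy.2)
  simp only [smul_eq_mul]
  refine Real.lt_sqrt_of_sq_lt ?_
  have hX := Real.sq_sqrt hx'
  have hY := Real.sq_sqrt hy'
  set X := √(α ^ 2 - x ^ 2)
  set Y := √(α ^ 2 - y ^ 2)
  have h1 : 0 < a * b * ((x - y) ^ 2 + (X - Y) ^ 2) := by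
    have : 0 < (x - y) ^ 2 := by have := sub_ne_zero.2 hxy; positivity
    positivity
  have h2 : α ^ 2 - (a * x + b * y) ^ 2 - (a * X + b * Y) ^ 2 =
      a * b * ((x - y) ^ 2 + (X - Y) ^ 2) := by
    obtain rfl : b = 1 - a := by linarith
    linear_combination (-a) * hX - (1 - a) * hY
  linarith

theorem StrictConcaveOn.add_lt_add_of_add_eq {s : Set ℝ} {f : ℝ → ℝ} (hf : StrictConcaveOn ℝ s f)
    {p q t u : ℝ} (hp : p ∈ s) (hu : u ∈ s) (hpq : p < q) (hpt : p < t) (h : p + u = q + t) :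
    f p + f u < f q + f t := by
  have hpu : 0 < u - p := by linarith
  have hqu : 0 < u - q := by linarith
  have e3 : (u - q) / (u - p) + (q - p) / (u - p) = 1 := by field_simp; ring
  have w₁ : 0 < (u - q) / (u - p) := div_pos hqu hpu
  have w₂ : 0 < (q - p) / (u - p) := div_pos (sub_pos.2 hpq) hpu
  have hq := hf.2 hp hu (by linarith : p < u).ne w₁ w₂ e3
  have ht := hf.2 hp hu (by linarith : p < u).ne w₂ w₁ (by rw [add_comm, e3])
  simp only [smul_eq_mul] at hq ht
  have e1 : (u - q) / (u - p) * p + (q - p) / (u - p) * u = q := by field_simp; ring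
  have e2 : (q - p) / (u - p) * p + (u - q) / (u - p) * u = t := by
    obtain rfl : t = p + u - q := by linarith
    field_simp; ring
  rw [e1] at hq
  rw [e2] at ht
  linear_combination hq + ht - (f p + f u) * e3

/-- Height over `s` of the lower half of the circle of radius `α` about `(a, b)`. -/
noncomputable def lowerArc (α a b s : ℝ) : ℝ := b - √(α ^ 2 - (s - a) ^ 2)

/-- Of two lower arcs of equal radius, the one with centre further left is the lower one only to
the left of the crossing. -/
theorem le_of_lowerArc_le {α a b a' b' s t : ℝ} (ha : a < a') (hs : |s - a| ≤ α)
    (ht : |t - a'| ≤ α) (h1 : lowerArc α a b s ≤ lowerArc α a' b' s)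
    (h2 : lowerArc α a' b' t ≤ lowerArc α a b t) : s ≤ t := by
  by_contra! hst
  -- If `t < s`, then `t - a'` and `s - a` are the extremes of the four offsets, so only these two
  -- need to be known to lie in the domain.
  have := (strictConcaveOn_sqrt_sq_sub_sq α).add_lt_add_of_add_eq (p := t - a') (q := t - a)
    (t := s - a') (u := s - a) (abs_le.1 ht) (abs_le.1 hs) (by linarith) (by linarith) (by ring)
  simp only [lowerArc] at h1 h2
  linarith

/-- If a convex combination of two reals is at least (or at most) both of them, then it takes the
graph values that they take. -/
theorem combination_eq_of_extreme {f g : ℝ → ℝ} {a b s₁ s₂ h₁ h₂ s : ℝ} (ha : 0 ≤ a) (hb : 0 ≤ b)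
    (hab : a + b = 1) (hs : a * s₁ + b * s₂ = s) (hext : s₁ ≤ s ∧ s₂ ≤ s ∨ s ≤ s₁ ∧ s ≤ s₂)
    (e₁ : h₁ = f s₁) (e₂ : h₂ = f s₂) (l₁ : f s₁ ≤ g s₁) (l₂ : f s₂ ≤ g s₂) :
    a * h₁ + b * h₂ = f s ∧ f s ≤ g s := by
  rcases ha.eq_or_lt with rfl | ha'
  · obtain rfl : b = 1 := by linarith
    obtain rfl : s₂ = s := by linarith
    exact ⟨by rw [e₂]; ring, l₂⟩
  rcases hb.eq_or_lt with rfl | hb'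
  · obtain rfl : a = 1 := by linarith
    obtain rfl : s₁ = s := by linarith
    exact ⟨by rw [e₁]; ring, l₁⟩
  -- Both deviations have the same sign and their weighted sum vanishes, so each is zero.
  have hz : a * (s - s₁) + b * (s - s₂) = 0 := by linear_combination s * hab - hs
  have h1 : s₁ = s := by
    rcases hext with ⟨h, h'⟩ | ⟨h, h'⟩
    · nlinarith [mul_nonneg hb (sub_nonneg.2 h'), mul_nonneg ha (sub_nonneg.2 h)]
    · nlinarith [mul_nonneg hb (sub_nonneg.2 h'), mul_nonneg ha (sub_nonneg.2 h)]
  have h2 : s₂ = s := by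
    rw [h1] at hz
    nlinarith
  rw [e₁, e₂, h1, h2, ← add_mul, hab, one_mul]
  exact ⟨rfl, h2 ▸ l₂⟩

/-- Two chords below lower arcs of equal radius, each with endpoints not above the other arc, have
equal height over a common abscissa, if the arcs have distinct centres. -/
theorem chord_height_eq {α a b a' b' s x₁ x₂ y₁ y₂ u₁ u₂ v₁ v₂ k l k' l' : ℝ}
    (hc : a ≠ a' ∨ b ≠ b')
    (hk : 0 ≤ k) (hl : 0 ≤ l) (hkl : k + l = 1) (hk' : 0 ≤ k') (hl' : 0 ≤ l') (hkl' : k' + l' = 1)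
    (hs : k * x₁ + l * y₁ = s) (hs' : k' * u₁ + l' * v₁ = s)
    (dx : |x₁ - a| ≤ α) (dy : |y₁ - a| ≤ α) (du : |u₁ - a'| ≤ α) (dv : |v₁ - a'| ≤ α)
    (ex : x₂ = lowerArc α a b x₁) (ey : y₂ = lowerArc α a b y₁)
    (eu : u₂ = lowerArc α a' b' u₁) (ev : v₂ = lowerArc α a' b' v₁)
    (lx : x₂ ≤ lowerArc α a' b' x₁) (ly : y₂ ≤ lowerArc α a' b' y₁)
    (lu : u₂ ≤ lowerArc α a b u₁) (lv : v₂ ≤ lowerArc α a b v₁) :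
    k * x₂ + l * y₂ = k' * u₂ + l' * v₂ := by
  have lx' := ex ▸ lx
  have ly' := ey ▸ ly
  have lu' := eu ▸ lu
  have lv' := ev ▸ lv
  -- All endpoints of the chord whose centre is further left precede those of the other, so the
  -- common abscissa `s` is extreme for both chords.
  have hext : (x₁ ≤ s ∧ y₁ ≤ s ∨ s ≤ x₁ ∧ s ≤ y₁) ∧ (u₁ ≤ s ∧ v₁ ≤ s ∨ s ≤ u₁ ∧ s ≤ v₁) := by
    have conv : ∀ {i j p q t : ℝ}, 0 ≤ i → 0 ≤ j → i + j = 1 → i * p + j * q = t →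
        (∀ m, p ≤ m → q ≤ m → t ≤ m) ∧ (∀ m, m ≤ p → m ≤ q → m ≤ t) := by
      intro i j p q t hi hj hij ht
      have hm : ∀ m, i * m + j * m = m := fun m => by rw [← add_mul, hij, one_mul]
      refine ⟨fun m hp hq => ?_, fun m hp hq => ?_⟩
      · linarith [mul_le_mul_of_nonneg_left hp hi, mul_le_mul_of_nonneg_left hq hj, hm m]
      · linarith [mul_le_mul_of_nonneg_left hp hi, mul_le_mul_of_nonneg_left hq hj, hm m]
    obtain ⟨c1, c2⟩ := conv hk hl hkl hs
    obtain ⟨c3, c4⟩ := conv hk' hl' hkl' hs'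
    rcases lt_trichotomy a a' with h | h | h
    · have xu := le_of_lowerArc_le h dx du lx' lu'
      have xv := le_of_lowerArc_le h dx dv lx' lv'
      have yu := le_of_lowerArc_le h dy du ly' lu'
      have yv := le_of_lowerArc_le h dy dv ly' lv'
      exact ⟨Or.inl ⟨c4 _ xu xv, c4 _ yu yv⟩, Or.inr ⟨c1 _ xu yu, c1 _ xv yv⟩⟩
    · exfalso
      subst h
      simp only [lowerArc] at lx' lu'
      rcases hc with h | h
      · exact h rfl
      · exact h (by linarith)
    · have xu := le_of_lowerArc_le h du dx lu' lx'
      have xv := le_of_lowerArc_le h dv dx lv' lx'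
      have yu := le_of_lowerArc_le h du dy lu' ly'
      have yv := le_of_lowerArc_le h dv dy lv' ly'
      exact ⟨Or.inr ⟨c3 _ xu xv, c3 _ yu yv⟩, Or.inl ⟨c2 _ xu yu, c2 _ xv yv⟩⟩
  obtain ⟨h1, h2⟩ := combination_eq_of_extreme hk hl hkl hs hext.1 ex ey lx' ly'
  obtain ⟨h3, h4⟩ := combination_eq_of_extreme hk' hl' hkl' hs' hext.2 eu ev lu' lv'
  rw [h1, h3]
  exact le_antisymm h2 h4

end LowerArcs

/-! ### Chords in tangential and normal coordinates. -/

section Edges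

open Metric

/-- Rotation by a right angle. -/
noncomputable def rotate (n : Plane) : Plane := !₂[-n 1, n 0]

theorem inner_rotate_self (n : Plane) : inner ℝ n (rotate n) = 0 := by
  simp [rotate, PiLp.inner_apply, Fin.sum_univ_two]; ring

theorem inner_sq_add_inner_rotate_sq {n : Plane} (hn : ‖n‖ = 1) (v : Plane) :
    inner ℝ v n ^ 2 + inner ℝ v (rotate n) ^ 2 = ‖v‖ ^ 2 := by
  have h1 : n 0 ^ 2 + n 1 ^ 2 = 1 := by
    have := EuclideanSpace.real_norm_sq_eq n
    rw [hn, Fin.sum_univ_two] at this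
    linarith
  rw [EuclideanSpace.real_norm_sq_eq v]
  simp only [rotate, PiLp.inner_apply, Fin.sum_univ_two, RCLike.inner_apply, conj_trivial,
    Matrix.cons_val_zero, Matrix.cons_val_one]
  linear_combination (v 0 ^ 2 + v 1 ^ 2) * h1

theorem eq_of_inner_eq {n : Plane} (hn : ‖n‖ = 1) {z w : Plane} (h1 : inner ℝ z n = inner ℝ w n)
    (h2 : inner ℝ z (rotate n) = inner ℝ w (rotate n)) : z = w := by
  have := inner_sq_add_inner_rotate_sq hn (z - w)
  rw [inner_sub_left, inner_sub_left, h1, h2, sub_self, sub_self] at this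
  rw [← sub_eq_zero, ← norm_eq_zero]
  exact pow_eq_zero_iff two_ne_zero |>.1 (by linarith)

/-- If the abscissa of `x` falls outside the circle, the square root takes its default value 0 and
the arc is read at the height of `c`; `hneg` covers this case. -/
theorem inner_le_lowerArc {n : Plane} (hn : ‖n‖ = 1) {α : ℝ} {x c : Plane} (h : α ≤ ‖x - c‖)
    (hα : 0 ≤ α) (hneg : inner ℝ (x - c) n ≤ 0) :
    inner ℝ x n ≤ lowerArc α (inner ℝ c (rotate n)) (inner ℝ c n) (inner ℝ x (rotate n)) := by
  have h1 := inner_sq_add_inner_rotate_sq hn (x - c)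
  have h2 : α ^ 2 ≤ ‖x - c‖ ^ 2 := by gcongr
  have h3 : √(α ^ 2 - inner ℝ (x - c) (rotate n) ^ 2) ≤ -inner ℝ (x - c) n :=
    Real.sqrt_le_iff.2 ⟨by linarith, by nlinarith⟩
  rw [inner_sub_left, inner_sub_left] at h3
  rw [lowerArc]
  linarith

theorem inner_eq_lowerArc {n : Plane} (hn : ‖n‖ = 1) {α : ℝ} {x c : Plane} (h : ‖x - c‖ = α)
    (hneg : inner ℝ (x - c) n ≤ 0) :
    inner ℝ x n = lowerArc α (inner ℝ c (rotate n)) (inner ℝ c n) (inner ℝ x (rotate n)) := by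
  have h1 := inner_sq_add_inner_rotate_sq hn (x - c)
  rw [h] at h1
  have h3 : √(α ^ 2 - inner ℝ (x - c) (rotate n) ^ 2) = -inner ℝ (x - c) n := by
    rw [show α ^ 2 - inner ℝ (x - c) (rotate n) ^ 2 = (-inner ℝ (x - c) n) ^ 2 by linarith]
    exact Real.sqrt_sq (by linarith)
  rw [inner_sub_left, inner_sub_left] at h3
  rw [lowerArc]
  linarith

theorem abs_inner_rotate_sub_le {n : Plane} (hn : ‖n‖ = 1) (x c : Plane) :
    |inner ℝ x (rotate n) - inner ℝ c (rotate n)| ≤ ‖x - c‖ := by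
  rw [← inner_sub_left]
  refine abs_le_of_sq_le_sq ?_ (norm_nonneg _)
  nlinarith [inner_sq_add_inner_rotate_sq hn (x - c), sq_nonneg (inner ℝ (x - c) n)]

/-- Points of two chords whose circumscribing lower arcs have distinct centres coincide when they
have the same abscissa. -/
theorem eq_of_mem_segment_of_center_ne {n : Plane} (hn : ‖n‖ = 1) {α : ℝ} (hα : 0 ≤ α)
    {x y c u v c' z w : Plane} (hc : c ≠ c') (hz : z ∈ segment ℝ x y) (hw : w ∈ segment ℝ u v)
    (hzw : inner ℝ z (rotate n) = inner ℝ w (rotate n))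
    (hx : ‖x - c‖ = α) (hy : ‖y - c‖ = α) (hu : ‖u - c'‖ = α) (hv : ‖v - c'‖ = α)
    (hx' : α ≤ ‖x - c'‖) (hy' : α ≤ ‖y - c'‖) (hu' : α ≤ ‖u - c‖) (hv' : α ≤ ‖v - c‖)
    (nx : inner ℝ (x - c) n ≤ 0) (ny : inner ℝ (y - c) n ≤ 0)
    (nu : inner ℝ (u - c') n ≤ 0) (nv : inner ℝ (v - c') n ≤ 0)
    (nx' : inner ℝ (x - c') n ≤ 0) (ny' : inner ℝ (y - c') n ≤ 0)
    (nu' : inner ℝ (u - c) n ≤ 0) (nv' : inner ℝ (v - c) n ≤ 0) : z = w := by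
  obtain ⟨k, l, hk, hl, hkl, rfl⟩ := hz
  obtain ⟨k', l', hk', hl', hkl', rfl⟩ := hw
  refine eq_of_inner_eq hn ?_ hzw
  simp only [inner_add_left, inner_smul_left, conj_trivial] at hzw ⊢
  refine chord_height_eq ?_ hk hl hkl hk' hl' hkl' hzw rfl
    ((abs_inner_rotate_sub_le hn x c).trans_eq hx) ((abs_inner_rotate_sub_le hn y c).trans_eq hy)
    ((abs_inner_rotate_sub_le hn u c').trans_eq hu) ((abs_inner_rotate_sub_le hn v c').trans_eq hv)
    (inner_eq_lowerArc hn hx nx) (inner_eq_lowerArc hn hy ny)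
    (inner_eq_lowerArc hn hu nu) (inner_eq_lowerArc hn hv nv)
    (inner_le_lowerArc hn hx' hα nx') (inner_le_lowerArc hn hy' hα ny')
    (inner_le_lowerArc hn hu' hα nu') (inner_le_lowerArc hn hv' hα nv')
  by_contra! h
  exact hc (eq_of_inner_eq hn h.2 h.1)

/-- A chord below a lower arc meets each vertical line at most once. -/
theorem eq_of_mem_segment_of_inner_eq {n : Plane} (hn : ‖n‖ = 1) {α : ℝ}
    {x y c z w : Plane} (hz : z ∈ segment ℝ x y) (hw : w ∈ segment ℝ x y)
    (hzw : inner ℝ z (rotate n) = inner ℝ w (rotate n))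
    (hx : ‖x - c‖ = α) (hy : ‖y - c‖ = α)
    (nx : inner ℝ (x - c) n ≤ 0) (ny : inner ℝ (y - c) n ≤ 0) : z = w := by
  obtain ⟨k, l, hk, hl, hkl, rfl⟩ := hz
  obtain ⟨k', l', hk', hl', hkl', rfl⟩ := hw
  simp only [inner_add_left, inner_smul_left, conj_trivial] at hzw
  have hl1 : k = 1 - l := by linarith
  have hl2 : k' = 1 - l' := by linarith
  have h0 : (l - l') * (inner ℝ y (rotate n) - inner ℝ x (rotate n)) = 0 := by
    rw [hl1, hl2] at hzw; linear_combination hzw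
  rcases mul_eq_zero.1 h0 with h | h
  · rw [hl1, hl2, sub_eq_zero.1 h]
  · have hs := sub_eq_zero.1 h
    have : y = x := eq_of_inner_eq hn
      (by rw [inner_eq_lowerArc hn hx nx, inner_eq_lowerArc hn hy ny, hs]) hs
    rw [this, ← add_smul, ← add_smul, hkl, hkl']

end Edges

/-! ### Flatness of edges of a dense sample. -/

section Deterministic

open Metric

/-- A mesh size at which every `α`-edge of a sample of an `r`-rolling set hugs its boundary. -/
noncomputable def meshSize (α r : ℝ) : ℝ := α * (r - α) / (1024 * r)

theorem meshSize_pos {α r : ℝ} (hα : 0 < α) (hαr : α < r) : 0 < meshSize α r :=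
  div_pos (mul_pos hα (sub_pos.2 hαr)) (by linarith)

theorem meshSize_mul {α r : ℝ} (hα : 0 < α) (hαr : α < r) :
    1024 * r * meshSize α r = α * (r - α) := by
  have : r ≠ 0 := by linarith
  rw [meshSize]; field_simp

theorem meshSize_le {α r : ℝ} (hα : 0 < α) (hαr : α < r) : meshSize α r ≤ α / 1024 := by
  rw [meshSize, div_le_div_iff₀ (by linarith) (by norm_num)]
  nlinarith

theorem exists_mem_metricProjection_frontier {S : Set Plane} (hS : IsCompact S) {x c : Plane}
    (hx : x ∈ S) (hc : c ∉ S) (z : Plane) : ∃ q, q ∈ metricProjection (frontier S) z :=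
  exists_mem_metricProjection (hS.of_isClosed_subset isClosed_frontier hS.isClosed.frontier_subset)
    (nonempty_frontier_iff.2 ⟨⟨x, hx⟩, fun h => hc (h ▸ Set.mem_univ c)⟩) z

theorem exists_foot {α r : ℝ} (hα : 0 < α) (hαr : α < r) {S : Set Plane} (hS : IsCompact S)
    (hro : RollingCondition r S) (hri : RollingCondition r Sᶜ) {x c : Plane} (hx : x ∈ S)
    (hxc : ‖x - c‖ = α) (hc : Disjoint (ball c (α - meshSize α r)) S) :
    ∃ p ∈ frontier S, ∃ m t, IsRollingNormal r S p m ∧ c = p + t • m ∧ α - meshSize α r ≤ t ∧ t ≤ α := by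
  have hr : 0 < r := hα.trans hαr
  have hε := meshSize_le hα hαr
  have hcS : c ∉ S := Set.disjoint_left.1 hc (mem_ball_self (by linarith))
  obtain ⟨p, hp⟩ := exists_mem_metricProjection_frontier hS hx hcS c
  obtain ⟨m, hm⟩ := exists_isRollingNormal hr hro hri hp.1
  have hpS : p ∈ S := hS.isClosed.frontier_subset hp.1
  have hpc : 0 < dist c p := dist_pos.2 fun h => hcS (h ▸ hpS)
  refine ⟨p, hp.1, m, dist c p, hm, ?_⟩
  rcases hm.exists_eq_add hr hp with ⟨hd, he⟩ | ⟨hd, -⟩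
  · refine ⟨he, ?_, ?_⟩
    · by_contra! h
      exact Set.disjoint_left.1 hc (by rwa [mem_ball, dist_comm]) hpS
    · by_contra! h
      exact Set.disjoint_left.1 hd (by rwa [mem_ball, dist_eq_norm, hxc]) hx
  · exact absurd hcS (Set.disjoint_left.1 hd (mem_ball_self hpc))

/-- As `x` avoids the outer `r`-ball at `p`, with `η = α - t` the inner product is at most `-α +
(2rη + η²) / (2(r - t))`. The factor `r - α` in `meshSize` absorbs the denominator. -/
theorem foot_estimates {α r : ℝ} (hα : 0 < α) (hαr : α < r) {S : Set Plane} {x p m : Plane} {t : ℝ}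
    (hm : IsRollingNormal r S p m) (ht : α - meshSize α r ≤ t) (ht' : t ≤ α) (hx : x ∈ S)
    (hxc : ‖x - (p + t • m)‖ = α) :
    inner ℝ (x - (p + t • m)) m ≤ -(511 / 512 * α) ∧ ‖x - p‖ ≤ α / 15 := by
  have hr : 0 < r := hα.trans hαr
  have hε := meshSize_le hα hαr
  have hε' := meshSize_mul hα hαr
  have hε0 := meshSize_pos hα hαr
  set ε := meshSize α r
  set v := x - (p + t • m) with hv
  have h1 : x ∉ ball (p + r • m) r := fun h => Set.disjoint_left.1 hm.outside h hx
  rw [mem_ball, not_lt, dist_eq_norm] at h1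
  have h2 : r ^ 2 ≤ ‖x - (p + r • m)‖ ^ 2 := by gcongr
  have e1 : x - (p + r • m) = v - (r - t) • m := by rw [hv]; module
  have e2 : x - p = v + t • m := by rw [hv]; module
  rw [e1, norm_sub_sq_real v, hxc, norm_smul, hm.norm_eq, inner_smul_right, mul_one,
    Real.norm_of_nonneg (by linarith)] at h2
  obtain ⟨η, rfl⟩ : ∃ η, t = α - η := ⟨α - t, by ring⟩
  have hη : 0 ≤ η := by linarith
  have hη' : η ≤ ε := by linarith
  have hrη : r * η ≤ r * ε := mul_le_mul_of_nonneg_left hη' hr.le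
  have hηη : η ^ 2 ≤ r * η := by nlinarith
  have h3 : inner ℝ v m ≤ -(511 / 512 * α) := by
    have hpos : 0 < 2 * (r - (α - η)) := by linarith
    refine le_of_mul_le_mul_left ?_ hpos
    have hαη : 0 ≤ α * η := by positivity
    nlinarith
  refine ⟨h3, ?_⟩
  refine le_of_sq_le_sq ?_ (by positivity)
  have ht0 : 0 ≤ α - η := by linarith
  rw [e2, norm_add_sq_real, hxc, norm_smul, hm.norm_eq, inner_smul_right, mul_one,
    Real.norm_of_nonneg ht0]
  have h4 := mul_le_mul_of_nonneg_left h3 ht0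
  have h5 : η ^ 2 ≤ (α / 1024) ^ 2 := by gcongr; linarith
  have h6 : 0 ≤ α * η := by positivity
  nlinarith

/-- The `α`-edge `[xy]` with empty ball about `c` near the boundary point `q` with normal `n`. -/
structure IsFlatEdge (α : ℝ) (D : Set Plane) (q n x y c : Plane) : Prop where
  mem_left : x ∈ D
  mem_right : y ∈ D
  disjoint : Disjoint (ball c α) D
  norm_left : ‖x - c‖ = α
  norm_right : ‖y - c‖ = α
  inner_left : inner ℝ (x - c) n ≤ -(4 / 5 * α)
  inner_right : inner ℝ (y - c) n ≤ -(4 / 5 * α)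
  dist_left : ‖x - q‖ ≤ α / 5
  dist_right : ‖y - q‖ ≤ α / 5

theorem isFlatEdge_of_disjoint {α r : ℝ} (hα : 0 < α) (hαr : α < r) {S D : Set Plane}
    (hS : IsCompact S) (hro : RollingCondition r S) (hri : RollingCondition r Sᶜ)
    (hDS : D ⊆ S) (hdense : ∀ s ∈ S, ∃ p ∈ D, dist s p ≤ meshSize α r) {x y c z q n : Plane}
    (hx : x ∈ D) (hy : y ∈ D) (hxy : Circumscribes α c x y) (hc : Disjoint (ball c α) D)
    (hz : z ∈ segment ℝ x y) (hq : q ∈ metricProjection (frontier S) z)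
    (hn : IsRollingNormal r S q n) : IsFlatEdge α D q n x y c ∧ dist z q < r := by
  have hr : 0 < r := hα.trans hαr
  have hc' : Disjoint (ball c (α - meshSize α r)) S := by
    refine Set.disjoint_left.2 fun s hs hsS => ?_
    obtain ⟨p, hp, hsp⟩ := hdense s hsS
    refine Set.disjoint_left.1 hc ?_ hp
    rw [mem_ball] at hs ⊢
    linarith [dist_triangle_left p c s]
  have hxc : ‖x - c‖ = α := by rw [← dist_eq_norm]; exact hxy.1
  have hyc : ‖y - c‖ = α := by rw [← dist_eq_norm]; exact hxy.2
  obtain ⟨p, hp, m, t, hm, rfl, ht, ht'⟩ := exists_foot hα hαr hS hro hri (hDS hx) hxc hc'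
  obtain ⟨ix, dx⟩ := foot_estimates hα hαr hm ht ht' (hDS hx) hxc
  obtain ⟨iy, dy⟩ := foot_estimates hα hαr hm ht ht' (hDS hy) hyc
  have hzp : dist z p ≤ α / 15 := (convex_closedBall p (α / 15)).segment_subset
    (by rwa [mem_closedBall, dist_eq_norm]) (by rwa [mem_closedBall, dist_eq_norm]) hz
  have hzq : dist z q ≤ α / 15 := (hq.2 p hp).trans hzp
  have hpq : ‖p - q‖ ≤ 2 * α / 15 := by
    rw [← dist_eq_norm]; linarith [dist_triangle_left p q z]
  -- The normal at the foot `q` of `z` replaces the one at the foot `p` of the centre, at the cost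
  -- of lowering `511/512` to `4/5`.
  have hmn : ‖n - m‖ ≤ 2 / 15 := by
    have h1 := hm.norm_sub_le hr hn
    rw [norm_sub_rev] at h1
    refine le_of_mul_le_mul_left ?_ hr
    nlinarith
  have hin : ∀ v : Plane, ‖v‖ = α → inner ℝ v m ≤ -(511 / 512 * α) →
      inner ℝ v n ≤ -(4 / 5 * α) := by
    intro v hv h
    have h1 : inner ℝ v (n - m) ≤ α * (2 / 15) :=
      (real_inner_le_norm _ _).trans (by rw [hv]; gcongr)
    rw [inner_sub_right] at h1
    linarith
  have hd : ∀ w : Plane, ‖w - p‖ ≤ α / 15 → ‖w - q‖ ≤ α / 5 := by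
    intro w hw
    linarith [norm_sub_le_norm_sub_add_norm_sub w p q]
  exact ⟨⟨hx, hy, hc, hxc, hyc, hin _ hxc ix, hin _ hyc iy, hd x dx, hd y dy⟩, by linarith⟩

theorem IsFlatEdge.not_reflect {α : ℝ} (hα : 0 < α) {D : Set Plane}
    {q n x y c : Plane} (h : IsFlatEdge α D q n x y c) :
    ¬ IsFlatEdge α D q n x y (x + y - c) := by
  intro h'
  have h1 := h'.inner_left
  rw [show x - (x + y - c) = -(y - c) by abel, inner_neg_left] at h1
  linarith [h.inner_right]

theorem IsFlatEdge.le_norm_sub {α : ℝ} {D : Set Plane} {q n x y c u : Plane}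
    (h : IsFlatEdge α D q n x y c) (hu : u ∈ D) : α ≤ ‖u - c‖ := by
  by_contra! hlt
  exact Set.disjoint_left.1 h.disjoint (by rwa [mem_ball, dist_eq_norm]) hu

/-- Puts points near `q`, including endpoints of other flat edges, below the centre, so that lower
arcs are the relevant ones. -/
theorem IsFlatEdge.inner_nonpos {α : ℝ} (hα : 0 ≤ α) {D : Set Plane} {q n x y c u : Plane}
    (h : IsFlatEdge α D q n x y c) (hn : ‖n‖ = 1) (hu : ‖u - q‖ ≤ α / 5) :
    inner ℝ (u - c) n ≤ 0 := by
  have h1 : inner ℝ (u - x) n ≤ 2 * α / 5 := by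
    refine (real_inner_le_norm _ _).trans ?_
    rw [hn, mul_one]
    have := norm_sub_le_norm_sub_add_norm_sub u q x
    rw [norm_sub_rev q x] at this
    linarith [h.dist_left]
  have h2 : inner ℝ (u - c) n = inner ℝ (u - x) n + inner ℝ (x - c) n := by
    rw [← inner_add_left, sub_add_sub_cancel]
  linarith [h.inner_left]

theorem IsFlatEdge.eq_of_inner_eq {α : ℝ} (hα : 0 ≤ α) {D : Set Plane}
    (hgp : ∀ x ∈ D, ∀ y ∈ D, ∀ u ∈ D, x ≠ y → u ≠ x → u ≠ y →
      ∀ c, ‖x - c‖ = α → ‖y - c‖ = α → ‖u - c‖ ≠ α)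
    {q n x y c u v c' z w : Plane} (hn : ‖n‖ = 1) (hxy : x ≠ y) (huv : u ≠ v)
    (h : IsFlatEdge α D q n x y c) (h' : IsFlatEdge α D q n u v c')
    (hz : z ∈ segment ℝ x y) (hw : w ∈ segment ℝ u v)
    (hzw : inner ℝ z (rotate n) = inner ℝ w (rotate n)) : z = w := by
  have nx := h.inner_nonpos hα hn h.dist_left
  have ny := h.inner_nonpos hα hn h.dist_right
  rcases ne_or_eq c c' with hc | rfl
  · exact eq_of_mem_segment_of_center_ne hn hα hc hz hw hzw h.norm_left h.norm_right h'.norm_left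
      h'.norm_right (h'.le_norm_sub h.mem_left) (h'.le_norm_sub h.mem_right)
      (h.le_norm_sub h'.mem_left) (h.le_norm_sub h'.mem_right) nx ny
      (h'.inner_nonpos hα hn h'.dist_left) (h'.inner_nonpos hα hn h'.dist_right)
      (h'.inner_nonpos hα hn h.dist_left) (h'.inner_nonpos hα hn h.dist_right)
      (h.inner_nonpos hα hn h'.dist_left) (h.inner_nonpos hα hn h'.dist_right)
  -- For a common centre, general position leaves only `x` and `y` on the circle, so both edges are
  -- the same chord.
  · have mem : ∀ u ∈ D, ‖u - c‖ = α → u = x ∨ u = y := by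
      intro u hu huc
      by_contra! hne
      exact hgp x h.mem_left y h.mem_right u hu hxy hne.1 hne.2 c h.norm_left h.norm_right huc
    have hw' : w ∈ segment ℝ x y := by
      rcases mem u h'.mem_left h'.norm_left with rfl | rfl <;>
        rcases mem v h'.mem_right h'.norm_right with rfl | rfl
      · exact absurd rfl huv
      · exact hw
      · rwa [segment_symm]
      · exact absurd rfl huv
    exact eq_of_mem_segment_of_inner_eq hn hz hw' hzw h.norm_left h.norm_right nx ny

/-- For a sufficiently dense sample without three points on a circle of radius `α`, all `α`-edges
are one-sided and the metric projection is injective on their union. -/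
theorem isOneSided_and_metricProjectionInjectiveOn {α r : ℝ} (hα : 0 < α) (hαr : α < r)
    {S D : Set Plane} (hS : IsCompact S) (hro : RollingCondition r S) (hri : RollingCondition r Sᶜ)
    (hDS : D ⊆ S) (hdense : ∀ s ∈ S, ∃ p ∈ D, dist s p ≤ meshSize α r)
    (hgp : ∀ x ∈ D, ∀ y ∈ D, ∀ u ∈ D, x ≠ y → u ≠ x → u ≠ y →
      ∀ c, ‖x - c‖ = α → ‖y - c‖ = α → ‖u - c‖ ≠ α) :
    (∀ x y : Plane, IsAlphaEdge α D x y → IsOneSided α D x y) ∧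
      MetricProjectionInjectiveOn (frontier S) (alphaEdgeUnion α D) := by
  have hr : 0 < r := hα.trans hαr
  have foot : ∀ x ∈ D, ∀ z, ∃ q n, q ∈ metricProjection (frontier S) z ∧
      IsRollingNormal r S q n := by
    intro x hx z
    obtain ⟨c, hc⟩ := (Set.ne_univ_iff_exists_notMem S).1 hS.ne_univ
    obtain ⟨q, hq⟩ := exists_mem_metricProjection_frontier hS (hDS hx) hc z
    obtain ⟨n, hn⟩ := exists_isRollingNormal hr hro hri hq.1
    exact ⟨q, n, hq, hn⟩
  have flat {x y c z q n : Plane} := isFlatEdge_of_disjoint (x := x) (y := y) (c := c) (z := z)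
    (q := q) (n := n) hα hαr hS hro hri hDS hdense
  refine ⟨?_, ?_, ?_⟩
  · rintro x y ⟨hx, hy, -, c, hcirc, hc⟩
    obtain ⟨q, n, hq, hn⟩ := foot x hx x
    have hcirc' : Circumscribes α (x + y - c) x y := by
      have h1 : dist x c = α := hcirc.1
      have h2 : dist y c = α := hcirc.2
      constructor
      · rw [mem_sphere, dist_eq_norm, show x - (x + y - c) = -(y - c) by abel, norm_neg,
          ← dist_eq_norm, h2]
      · rw [mem_sphere, dist_eq_norm, show y - (x + y - c) = -(x - c) by abel, norm_neg,
          ← dist_eq_norm, h1]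
    refine ⟨x + y - c, hcirc', ?_⟩
    rw [← Set.not_disjoint_iff_nonempty_inter]
    intro hc'
    exact (flat hx hy hcirc hc (left_mem_segment ℝ x y) hq hn).1.not_reflect hα
      (flat hx hy hcirc' hc' (left_mem_segment ℝ x y) hq hn).1
  · rintro z ⟨x, y, ⟨hx, hy, -, c, hcirc, hc⟩, hz⟩
    obtain ⟨q, n, hq, hn⟩ := foot x hx z
    exact ⟨q, hn.metricProjection_eq hr hq (flat hx hy hcirc hc hz hq hn).2⟩
  · rintro z ⟨x, y, ⟨hx, hy, hxy, c, hcirc, hc⟩, hz⟩ w ⟨u, v, ⟨hu, hv, huv, c', hcirc', hc'⟩, hw⟩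
      heq
    obtain ⟨q, n, hq, hn⟩ := foot x hx z
    have hq' : q ∈ metricProjection (frontier S) w := heq ▸ hq
    -- Points with foot `q` share the tangential coordinate of `q`.
    have line : ∀ {z}, q ∈ metricProjection (frontier S) z →
        inner ℝ z (rotate n) = inner ℝ q (rotate n) := by
      intro z hz
      rcases hn.exists_eq_add hr hz with ⟨-, h⟩ | ⟨-, h⟩ <;> rw [h] <;>
        simp only [inner_add_left, inner_sub_left, inner_smul_left, inner_rotate_self, mul_zero,
          add_zero, sub_zero]
    exact (flat hx hy hcirc hc hz hq hn).1.eq_of_inner_eq hα.le hgp hn.norm_eq hxy huv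
      (flat hu hv hcirc' hc' hw hq' hn).1 hz hw ((line hq).trans (line hq').symm)

end Deterministic

/-! ### Mass of small balls and general position of the sample. -/

section Sampling

open Metric MeasureTheory ProbabilityTheory

/-- Every ball about a point of `S` contains a ball of a quarter of its radius inside `S`. -/
theorem exists_ball_subset_inter {r δ : ℝ} (hδ : 0 < δ) (hδr : δ / 4 ≤ r) {S : Set Plane}
    (hro : RollingCondition r S) (hri : RollingCondition r Sᶜ) {s : Plane} (hs : s ∈ S) :
    ∃ b, ball b (δ / 4) ⊆ S ∩ ball s δ := by
  by_cases h : Disjoint (ball s (δ / 2)) (frontier S)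
  · rcases disjoint_or_disjoint_compl_of_disjoint_frontier
      (convex_ball s (δ / 2)).isPreconnected h with h' | h'
    · exact absurd hs (Set.disjoint_left.1 h' (mem_ball_self (by linarith)))
    · exact ⟨s, Set.subset_inter ((ball_subset_ball (by linarith)).trans
        (Set.disjoint_compl_right_iff_subset.1 h')) (ball_subset_ball (by linarith))⟩
  · obtain ⟨q, hq, hqS⟩ := Set.not_disjoint_iff.1 h
    have hr : 0 < r := by linarith
    obtain ⟨n, hn⟩ := exists_isRollingNormal hr hro hri hqS
    have hnorm : ∀ t : ℝ, 0 ≤ t → ‖t • n‖ = t := fun t ht => by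
      rw [norm_smul, hn.norm_eq, mul_one, Real.norm_of_nonneg ht]
    -- This ball touches the boundary at `q` from within the inner `r`-ball; it stays in `ball s δ`
    -- since `δ/4 + δ/4 + δ/2 = δ`.
    refine ⟨q - (δ / 4) • n, Set.subset_inter ?_ ?_⟩
    · refine (ball_subset_ball' ?_).trans (Set.disjoint_compl_right_iff_subset.1 hn.inside)
      rw [dist_eq_norm, show q - (δ / 4) • n - (q - r • n) = (r - δ / 4) • n by module,
        hnorm _ (by linarith)]
      linarith
    · refine ball_subset_ball' ?_
      have h1 : dist (q - (δ / 4) • n) q = δ / 4 := by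
        rw [dist_eq_norm, sub_sub_cancel_left, norm_neg, hnorm _ (by linarith)]
      rw [mem_ball] at hq
      linarith [dist_triangle (q - (δ / 4) • n) q s]

variable {Ω : Type*} [MeasurableSpace Ω] {P : Measure Ω}

theorem ae_forall_mem_of_isUniform {S : Set Plane} (hS : MeasurableSet S) {n : ℕ}
    {X : Fin n → Ω → Plane} (hX : ∀ i, Measurable (X i))
    (hu : ∀ i, pdf.IsUniform (X i) S P volume) : ∀ᵐ ω ∂P, ∀ i, X i ω ∈ S := by
  rw [ae_all_iff]
  intro i
  refine ae_of_ae_map (hX i).aemeasurable ?_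
  rw [hu i]
  exact ae_cond_mem hS

variable [IsProbabilityMeasure P]

theorem volume_ne_zero_of_isUniform {S : Set Plane} {X : Ω → Plane} (hX : Measurable X)
    (hu : pdf.IsUniform X S P volume) : volume S ≠ 0 := by
  intro h
  have := Measure.isProbabilityMeasure_map (μ := P) hX.aemeasurable
  rw [hu, cond_eq_zero_of_meas_eq_zero h] at this
  exact this.ne_zero _ rfl

theorem le_measureReal_preimage_of_isUniform {S G : Set Plane} {X : Ω → Plane} {s₀ b : Plane}
    {R ρ : ℝ} (hX : Measurable X) (hu : pdf.IsUniform X S P volume) (hSR : S ⊆ closedBall s₀ R)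
    (hG : MeasurableSet G) (hb : ball b ρ ⊆ S ∩ G) :
    volume.real (ball (0 : Plane) ρ) / volume.real (closedBall (0 : Plane) R) ≤
      P.real (X ⁻¹' G) := by
  have h0 := volume_ne_zero_of_isUniform hX hu
  have htop : volume S ≠ ⊤ := measure_ne_top_of_subset hSR measure_closedBall_lt_top.ne
  have h1 : P.real (X ⁻¹' G) = volume.real (S ∩ G) / volume.real S := by
    rw [measureReal_def, hu.measure_preimage h0 htop hG, ENNReal.toReal_div]; rfl
  have h2 : volume.real (ball (0 : Plane) ρ) ≤ volume.real (S ∩ G) := by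
    have : volume.real (ball b ρ) ≤ volume.real (S ∩ G) :=
      measureReal_mono hb (measure_ne_top_of_subset Set.inter_subset_left htop)
    rwa [measureReal_def, Measure.addHaar_ball_center] at this
  have h3 : volume.real S ≤ volume.real (closedBall (0 : Plane) R) := by
    have : volume.real S ≤ volume.real (closedBall s₀ R) :=
      measureReal_mono hSR measure_closedBall_lt_top.ne
    rwa [measureReal_def _ (closedBall s₀ R), Measure.addHaar_closedBall_center] at this
  have h4 : 0 < volume.real S := ENNReal.toReal_pos h0 htop
  rw [h1]
  gcongr

/-- The probability that `n` independent points all miss a set is exponentially small. -/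
theorem measureReal_forall_notMem_le {n : ℕ} {X : Fin n → Ω → Plane} (hX : ∀ i, Measurable (X i))
    (hind : iIndepFun X P) {G : Set Plane} (hG : MeasurableSet G) {c : ℝ}
    (hc : ∀ i, c ≤ P.real (X i ⁻¹' G)) :
    P.real (⋂ i, X i ⁻¹' Gᶜ) ≤ Real.exp (-(c * n)) := by
  have h1 := hind.measure_inter_preimage_eq_mul Finset.univ (sets := fun _ => Gᶜ)
    fun _ _ => hG.compl
  simp only [Finset.mem_univ, Set.iInter_true] at h1
  rw [measureReal_def, h1, ENNReal.toReal_prod]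
  calc ∏ i : Fin n, (P (X i ⁻¹' Gᶜ)).toReal ≤ ∏ _i : Fin n, Real.exp (-c) := by
        refine Finset.prod_le_prod (fun _ _ => ENNReal.toReal_nonneg) fun i _ => ?_
        rw [← measureReal_def, Set.preimage_compl, probReal_compl_eq_one_sub (hX i hG)]
        linarith [hc i, Real.add_one_le_exp (-c)]
    _ = Real.exp (-(c * n)) := by
        rw [Finset.prod_const, Finset.card_univ, Fintype.card_fin, ← Real.exp_nat_mul]
        congr 1; ring

/-- By independence the joint law is a product, and each slice is a sphere about `f w`, which is
Lebesgue null. -/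
theorem ae_dist_ne_of_indepFun {β : Type*} [MeasurableSpace β] {W : Ω → β} {Z : Ω → Plane}
    (hW : Measurable W) (hZ : Measurable Z) (hind : IndepFun W Z P) (hac : P.map Z ≪ volume)
    {f : β → Plane} (hf : Measurable f) (α : ℝ) : ∀ᵐ ω ∂P, dist (Z ω) (f (W ω)) ≠ α := by
  have hs : MeasurableSet {p : β × Plane | dist p.2 (f p.1) = α} :=
    measurableSet_eq_fun (measurable_snd.dist (hf.comp measurable_fst)) measurable_const
  have := Measure.isProbabilityMeasure_map (μ := P) hZ.aemeasurable
  have h0 : P.map (fun ω => (W ω, Z ω)) {p : β × Plane | dist p.2 (f p.1) = α} = 0 := by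
    rw [hind.map_prod_eq_prod_map_map hW.aemeasurable hZ.aemeasurable, Measure.measure_prod_null hs]
    exact Filter.Eventually.of_forall fun w => hac (Measure.addHaar_sphere volume (f w) α)
  rw [Measure.map_apply (hW.prodMk hZ) hs] at h0
  exact measure_eq_zero_iff_ae_notMem.1 h0

/-- The two centres of circles of radius `α` through a pair of points. -/
noncomputable def chordCenter (α σ : ℝ) (p : Plane × Plane) : Plane :=
  (2⁻¹ : ℝ) • (p.1 + p.2) + (σ * √(α ^ 2 / ‖p.2 - p.1‖ ^ 2 - 1 / 4)) • rotate (p.2 - p.1)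

theorem measurable_chordCenter (α σ : ℝ) : Measurable (chordCenter α σ) := by
  have : Continuous rotate := by unfold rotate; fun_prop
  have := this.measurable
  unfold chordCenter
  fun_prop

theorem eq_chordCenter {α : ℝ} {x y c : Plane} (hxy : x ≠ y) (hx : ‖x - c‖ = α)
    (hy : ‖y - c‖ = α) : c = chordCenter α 1 (x, y) ∨ c = chordCenter α (-1) (x, y) := by
  have hw : 0 < ‖y - x‖ ^ 2 := by
    have := norm_pos_iff.2 (sub_ne_zero.2 hxy.symm); positivity
  have hw' := EuclideanSpace.real_norm_sq_eq (y - x)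
  have hx' := EuclideanSpace.real_norm_sq_eq (x - c)
  have hy' := EuclideanSpace.real_norm_sq_eq (y - c)
  rw [hx] at hx'
  rw [hy] at hy'
  simp only [Fin.sum_univ_two, PiLp.sub_apply] at hw' hx' hy'
  set W := ‖y - x‖ ^ 2 with hW
  -- The centre lies on the perpendicular bisector; `k` is its coordinate along `rotate (y - x)`,
  -- measured from the midpoint.
  obtain ⟨k, hk⟩ : ∃ k, k * W = (c 1 - (x 1 + y 1) / 2) * (y 0 - x 0) -
      (c 0 - (x 0 + y 0) / 2) * (y 1 - x 1) := ⟨_, div_mul_cancel₀ _ hw.ne'⟩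
  have hc0 : c 0 = (x 0 + y 0) / 2 - k * (y 1 - x 1) := by
    refine mul_left_cancel₀ hw.ne' ?_
    linear_combination (c 0 - (x 0 + y 0) / 2) * hw' + (y 1 - x 1) * hk +
      (y 0 - x 0) / 2 * (hy' - hx')
  have hc1 : c 1 = (x 1 + y 1) / 2 + k * (y 0 - x 0) := by
    refine mul_left_cancel₀ hw.ne' ?_
    linear_combination (c 1 - (x 1 + y 1) / 2) * hw' - (y 0 - x 0) * hk +
      (y 1 - x 1) / 2 * (hy' - hx')
  have hk2 : α ^ 2 / W - 1 / 4 = k ^ 2 := by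
    rw [sub_eq_iff_eq_add, div_eq_iff hw.ne']
    rw [hc0, hc1] at hx'
    rw [hx', hw']; ring
  have hc : c = (2⁻¹ : ℝ) • (x + y) + k • rotate (y - x) := by
    ext i
    fin_cases i
    · simp [rotate]; rw [hc0]; ring
    · simp [rotate]; rw [hc1]; ring
  simp only [chordCenter, ← hW, hk2, Real.sqrt_sq_eq_abs, one_mul, neg_one_mul]
  rcases abs_choice k with h | h
  · left; rw [h]; exact hc
  · right; rw [h, neg_neg]; exact hc

theorem ae_no_three_on_circle {S : Set Plane} {n : ℕ} {X : Fin n → Ω → Plane}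
    (hX : ∀ i, Measurable (X i)) (hind : iIndepFun X P)
    (hu : ∀ i, pdf.IsUniform (X i) S P volume) (α : ℝ) :
    ∀ᵐ ω ∂P, ∀ x ∈ Set.range fun i => X i ω, ∀ y ∈ Set.range fun i => X i ω,
      ∀ u ∈ Set.range fun i => X i ω, x ≠ y → u ≠ x → u ≠ y →
        ∀ c, ‖x - c‖ = α → ‖y - c‖ = α → ‖u - c‖ ≠ α := by
  have h : ∀ i j k, i ≠ k → j ≠ k → ∀ σ, ∀ᵐ ω ∂P,
      dist (X k ω) (chordCenter α σ (X i ω, X j ω)) ≠ α := fun i j k hik hjk σ =>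
    ae_dist_ne_of_indepFun ((hX i).prodMk (hX j)) (hX k) (hind.indepFun_prodMk hX i j k hik hjk)
      (hu k).absolutelyContinuous (measurable_chordCenter α σ) α
  have h' : ∀ᵐ ω ∂P, ∀ i j k, i ≠ k → j ≠ k →
      dist (X k ω) (chordCenter α 1 (X i ω, X j ω)) ≠ α ∧
      dist (X k ω) (chordCenter α (-1) (X i ω, X j ω)) ≠ α := by
    simp only [ae_all_iff]
    intro i j k hik hjk
    exact (h i j k hik hjk 1).and (h i j k hik hjk (-1))
  filter_upwards [h'] with ω hω
  rintro _ ⟨i, rfl⟩ _ ⟨j, rfl⟩ _ ⟨k, rfl⟩ hij hki hkj c hxc hyc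
  have hk := hω i j k (fun e => hki (e ▸ rfl)) (fun e => hkj (e ▸ rfl))
  rcases eq_chordCenter hij hxc hyc with rfl | rfl
  · rw [← dist_eq_norm]; exact hk.1
  · rw [← dist_eq_norm]; exact hk.2

end Sampling

/-! ### The probability bound, uniform in the set. -/

theorem mainTheorem4 (α r d : ℝ) (hα : 0 < α) (hαr : α < r) :
    ∃ A : ℝ, 0 < A ∧
      ∀ S : Set Plane, IsCompact S → RollingCondition r S → RollingCondition r Sᶜ →
        Metric.diam S = d →
      ∀ (Ω : Type*) [MeasurableSpace Ω] (P : MeasureTheory.Measure Ω)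
        [MeasureTheory.IsProbabilityMeasure P] (n : ℕ) (X : Fin n → Ω → Plane),
        (∀ i, Measurable (X i)) →
        ProbabilityTheory.iIndepFun X P →
        (∀ i, MeasureTheory.pdf.IsUniform (X i) S P MeasureTheory.volume) →
        ∃ E : Set Ω, MeasurableSet E ∧ 1 - A * Real.exp (-(n : ℝ) / A) ≤ P.real E ∧
          ∀ ω ∈ E,
            (∀ x y : Plane, IsAlphaEdge α (Set.range fun i => X i ω) x y →
              IsOneSided α (Set.range fun i => X i ω) x y) ∧
            MetricProjectionInjectiveOn (frontier S)
              (alphaEdgeUnion α (Set.range fun i => X i ω)) := by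
  have hε := meshSize_pos hα hαr
  have hεα := meshSize_le hα hαr
  have hR : 0 < |d| + 1 := by positivity
  -- The net is fixed before `S` and later translated by a point of `S`, so its size depends on α, r
  -- and d only. The radius `|d| + 1` is positive for every real `d`.
  obtain ⟨T, -, hTfin, hT⟩ := (isCompact_closedBall (0 : Plane) (|d| + 1)).finite_cover_balls
    (by linarith : 0 < meshSize α r / 4)
  set c₀ := MeasureTheory.volume.real (Metric.ball (0 : Plane) (meshSize α r / 2 / 4)) /
    MeasureTheory.volume.real (Metric.closedBall (0 : Plane) (|d| + 1)) with hc₀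
  have hc₀pos : 0 < c₀ := div_pos
    (ENNReal.toReal_pos (Metric.measure_ball_pos _ _ (by linarith)).ne'
      MeasureTheory.measure_ball_lt_top.ne)
    (ENNReal.toReal_pos (Metric.measure_closedBall_pos _ _ hR).ne'
      MeasureTheory.measure_closedBall_lt_top.ne)
  -- The cardinality pays for the union bound, `1 / c₀` for the exponential rate, and the final 1
  -- makes the bound trivial for `n = 0`.
  set A : ℝ := hTfin.toFinset.card + 1 / c₀ + 1 with hA
  have hc₀inv : 0 < 1 / c₀ := by positivity
  have hA1 : 1 ≤ A := by
    have : (0 : ℝ) ≤ hTfin.toFinset.card := Nat.cast_nonneg _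
    linarith
  refine ⟨A, by linarith, ?_⟩
  intro S hS hro hri hd Ω _ P _ n X hX hind hu
  rcases Nat.eq_zero_or_pos n with rfl | hn
  · refine ⟨∅, MeasurableSet.empty, ?_, fun ω hω => hω.elim⟩
    simpa using hA1
  have hS0 : MeasureTheory.volume S ≠ 0 := volume_ne_zero_of_isUniform (hX ⟨0, hn⟩) (hu ⟨0, hn⟩)
  obtain ⟨s₀, hs₀⟩ := MeasureTheory.nonempty_of_measure_ne_zero hS0
  have hSR : S ⊆ Metric.closedBall s₀ (|d| + 1) := fun s hs => by
    rw [Metric.mem_closedBall]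
    linarith [Metric.dist_le_diam_of_mem hS.isBounded hs hs₀, le_abs_self d]
  -- Net points need not lie in `S`: each is replaced by a nearby point of `S`, or by the dummy `s₀`
  -- when there is none.
  have hrep : ∀ f : Plane, ∃ s ∈ S, ∀ s' ∈ S, dist s' (s₀ + f) < meshSize α r / 4 →
      dist s' s < meshSize α r / 2 := by
    intro f
    by_cases h : ∃ s ∈ S, dist s (s₀ + f) < meshSize α r / 4
    · obtain ⟨s, hs, hsf⟩ := h
      refine ⟨s, hs, fun s' _ hs' => ?_⟩
      linarith [dist_triangle_right s' s (s₀ + f)]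
    · push Not at h
      exact ⟨s₀, hs₀, fun s' hs' hlt => absurd hlt (h s' hs').not_gt⟩
  choose rep hrepS hrep using hrep
  have hmiss : ∀ f, P.real (⋂ i, X i ⁻¹' (Metric.ball (rep f) (meshSize α r / 2))ᶜ) ≤
      Real.exp (-(c₀ * n)) := fun f => by
    obtain ⟨b, hb⟩ := exists_ball_subset_inter (δ := meshSize α r / 2) (r := r) (by linarith)
      (by linarith) hro hri (hrepS f)
    exact measureReal_forall_notMem_le hX hind measurableSet_ball fun i =>
      le_measureReal_preimage_of_isUniform (hX i) (hu i) hSR measurableSet_ball hb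
  set B : Set Ω := ⋃ f ∈ hTfin.toFinset,
    ⋂ i, X i ⁻¹' (Metric.ball (rep f) (meshSize α r / 2))ᶜ with hB
  have hBmeas : MeasurableSet B := Finset.measurableSet_biUnion _ fun f _ =>
    MeasurableSet.iInter fun i => hX i measurableSet_ball.compl
  have hBle : P.real B ≤ A * Real.exp (-(n : ℝ) / A) := by
    calc P.real B ≤ ∑ f ∈ hTfin.toFinset, Real.exp (-(c₀ * n)) :=
          (MeasureTheory.measureReal_biUnion_finset_le _ _).trans
            (Finset.sum_le_sum fun f _ => hmiss f)
      _ = hTfin.toFinset.card * Real.exp (-(c₀ * n)) := by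
          rw [Finset.sum_const, nsmul_eq_mul]
      _ ≤ A * Real.exp (-(n : ℝ) / A) := by
          gcongr
          · linarith
          · rw [neg_div, neg_le_neg_iff, div_le_iff₀ (by linarith)]
            have h1 : 1 ≤ c₀ * A := by
              rw [← div_le_iff₀' hc₀pos]
              have : (0 : ℝ) ≤ hTfin.toFinset.card := Nat.cast_nonneg _
              linarith
            nlinarith [Nat.cast_nonneg (α := ℝ) n]
  have hae := (ae_forall_mem_of_isUniform hS.measurableSet hX hu).and
    (ae_no_three_on_circle hX hind hu α)
  obtain ⟨N, hNsub, hNmeas, hN0⟩ := MeasureTheory.exists_measurable_superset_of_null hae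
  refine ⟨Bᶜ \ N, hBmeas.compl.diff hNmeas, ?_, ?_⟩
  · rw [MeasureTheory.measureReal_def, MeasureTheory.measure_sdiff_null hN0,
      ← MeasureTheory.measureReal_def, MeasureTheory.probReal_compl_eq_one_sub hBmeas]
    linarith
  · rintro ω ⟨hωB, hωN⟩
    obtain ⟨hmem, hgp⟩ := not_not.1 fun h => hωN (hNsub h)
    refine isOneSided_and_metricProjectionInjectiveOn hα hαr hS hro hri
      (Set.range_subset_iff.2 hmem) ?_ hgp
    intro s hs
    have hs' : s - s₀ ∈ Metric.closedBall (0 : Plane) (|d| + 1) := by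
      rw [mem_closedBall_zero_iff, ← dist_eq_norm]; exact hSR hs
    obtain ⟨f, hf, hsf⟩ := Set.mem_iUnion₂.1 (hT hs')
    have hsf' : dist s (s₀ + f) < meshSize α r / 4 := by
      rw [dist_eq_norm, ← sub_sub, ← dist_eq_norm]; exact hsf
    have hex : ∃ i, X i ω ∈ Metric.ball (rep f) (meshSize α r / 2) := by
      by_contra! h
      exact hωB (Set.mem_biUnion (hTfin.mem_toFinset.2 hf) (Set.mem_iInter.2 h))
    obtain ⟨i, hi⟩ := hex
    refine ⟨X i ω, ⟨i, rfl⟩, ?_⟩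
    rw [Metric.mem_ball] at hi
    linarith [hrep f s hs hsf', dist_triangle_right s (X i ω) (rep f)]
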